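/- Let $\eta$ be a probability measure on $\mathbb{R}$ that is absolutely continuous with respect to Lebesgue measure, with distribution function $F_\eta$ and left-continuous inverse $F_\eta^{-1}(u)=\inf\{x\in\mathbb{R}: F_\eta(x)\ge u\}$, and let $f:\mathbb{R}\to\mathbb{R}$ be continuous and $\eta$-integrable. Let $\Lambda_2(\eta)$ be the set of couplings, i.e. of measures on $\mathbb{R}^2$ both of whose marginals are $\eta$. For $n\ge 1$ and a permutation $\sigma$ of $\{1,\dots,n\}$, let $\mu^{(\sigma)}$ be the image, under applying $F_\eta^{-1}$ to each coordinate, of the measure on $[0,1]^2$ with density $p_\sigma(x,y)=n\,1_{\sigma(\lceil nx\rceil)=\lceil ny\rceil}$, where points at which $\lceil nx\rceil$ or $\lceil ny\rceil$ is not in $\{1,\dots,n\}$ get density $0$. Let $\Lambda^{(\sigma)}_n$ be the set of all $\mu^{(\sigma)}$ with $\sigma$ of order $n$. Call $\mu\in\Lambda_2(\eta)$ variance-minimising if the variance (in $[0,\infty]$) of the two-sample estimator $\tfrac12(f(\omega_1)+f(\omega_2))$ of $\mathbb{E}_{\omega\sim\eta}f(\omega)$ under $(\omega_1,\omega_2)\sim\mu$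 is smallest among all couplings in $\Lambda_2(\eta)$. Then: (i) $\Lambda^{(\sigma)}_n\subseteq\Lambda_2(\eta)$ for every $n\ge 1$; (ii) if $f\in L^2(\eta)$, then the variance-minimising couplings are exactly the optimal transport plans, i.e. the minimisers of $\mathbb{E}_{(\omega_1,\omega_2)\sim\mu}[f(\omega_1)f(\omega_2)]$ over $\mu\in\Lambda_2(\eta)$; (iii) a variance-minimising coupling exists; (iv) for every variance-minimising coupling $\mu^*$ there are $\nu_n\in\Lambda^{(\sigma)}_n$, $n\ge 1$, such that $\nu_n\to\mu^*$ weakly as $n\to\infty$. -/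

import Mathlib

open MeasureTheory ProbabilityTheory Filter Topology

noncomputable section

/-- The left-continuous inverse `F_η⁻¹ (u) = inf {x ∈ ℝ : F_η x ≥ u}` of the cumulative
distribution function of `η`. -/
def quantile (η : Measure ℝ) (u : ℝ) : ℝ :=
  sInf {x : ℝ | u ≤ cdf η x}

/-- The permutation density `p_σ (x, y) = n 1_{σ ⌈n x⌉ = ⌈n y⌉}`. The index `i : Fin n` stands for
the label `i + 1 ∈ {1, …, n}`. -/
def permDensity {n : ℕ} (σ : Equiv.Perm (Fin n)) : ℝ × ℝ → ENNReal :=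
  Set.indicator
    {p : ℝ × ℝ | ∃ i : Fin n,
      ⌈(n : ℝ) * p.1⌉ = ((i : ℕ) : ℤ) + 1 ∧ ⌈(n : ℝ) * p.2⌉ = ((σ i : ℕ) : ℤ) + 1}
    (fun _ => (n : ENNReal))

/-- The measure on the unit square `[0, 1]²` with density `p_σ`. -/
def permMeasure {n : ℕ} (σ : Equiv.Perm (Fin n)) : Measure (ℝ × ℝ) :=
  (volume.restrict (Set.Icc (0 : ℝ) 1 ×ˢ Set.Icc (0 : ℝ) 1)).withDensity (permDensity σ)

/-- The measure `μ^(σ)`: the permutation density pushed forward coordinate-wise by `F_η⁻¹`. -/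
def permCoupling (η : Measure ℝ) {n : ℕ} (σ : Equiv.Perm (Fin n)) : Measure (ℝ × ℝ) :=
  (permMeasure σ).map (Prod.map (quantile η) (quantile η))

/-- The class of all `μ^(σ)` with `σ` a permutation of order `n`. -/
def permClass (η : Measure ℝ) (n : ℕ) : Set (Measure (ℝ × ℝ)) :=
  Set.range fun σ : Equiv.Perm (Fin n) => permCoupling η σ

/-- The set `Λ₂(η)` of couplings: joint laws both of whose marginals are `η`. -/
def couplings (η : Measure ℝ) : Set (Measure (ℝ × ℝ)) :=
  {μ | μ.map Prod.fst = η ∧ μ.map Prod.snd = η}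

/-- The estimator of the expectation of `f` from two samples. -/
def pairEstimator (f : ℝ → ℝ) (ω : ℝ × ℝ) : ℝ :=
  (f ω.1 + f ω.2) / 2

/-- `μ` is a coupling of `η` with itself with the smallest estimator variance among all couplings.
The variance takes values in `[0, ∞]`. -/
def IsVarianceMinimising (η : Measure ℝ) (f : ℝ → ℝ) (μ : Measure (ℝ × ℝ)) : Prop :=
  μ ∈ couplings η ∧
    ∀ μ' ∈ couplings η, evariance (pairEstimator f) μ ≤ evariance (pairEstimator f) μ'

/-- `μ` solves the Kantorovich problem on `Λ₂(η)` with cost `c (ω₁, ω₂) = f ω₁ * f ω₂`. -/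
def IsOptimalPlan (η : Measure ℝ) (f : ℝ → ℝ) (μ : Measure (ℝ × ℝ)) : Prop :=
  μ ∈ couplings η ∧
    ∀ μ' ∈ couplings η, ∫ ω, f ω.1 * f ω.2 ∂μ ≤ ∫ ω, f ω.1 * f ω.2 ∂μ'

end

/-! The limit claim uses only that a minimiser is a coupling: permutation couplings are weakly dense
in `couplings η`. Draw an i.i.d. sample from `μ` and let `rankPerm` match first-coordinate ranks
with second-coordinate ranks. If the cut-offs `j`, `l` count the sample points with first coordinate
`≤ s`, respectively second `≤ t`, then `permMeasure` at the grid point `(j/n, l/n)` is exactly the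
empirical joint distribution function at `(s, t)` (`card_filter_rankPerm`). Moving from the grid
point to `(cdf η s, cdf η t)` costs at most the marginal errors (`abs_permCoupling_real_sub_le`),
which vanish by the strong law.

The estimator has the same mean under all couplings. Its variance is therefore increasing and affine
in `∫ f ω₁ f ω₂` for `f ∈ L²`, and in general is a lower semicontinuous function on a weakly compact
set, so a minimum is attained. -/

/-! ### The quantile transform. -/

section Quantile

/-- Right-continuity of the distribution function makes the infimum attained; `0 < u < 1` makes the
set bounded below and nonempty. -/
lemma quantile_le_iff (η : Measure ℝ) {u : ℝ} (h0 : 0 < u) (h1 : u < 1) (s : ℝ) :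
    quantile η u ≤ s ↔ u ≤ cdf η s := by
  have hbdd : BddBelow {x : ℝ | u ≤ cdf η x} := by
    obtain ⟨a, ha⟩ := ((tendsto_order.1 (tendsto_cdf_atBot η)).2 u h0).exists
    refine ⟨a, fun x hx => ?_⟩
    by_contra! h
    exact absurd (hx.trans (monotone_cdf η h.le)) (not_le.2 ha)
  have hne : {x : ℝ | u ≤ cdf η x}.Nonempty := by
    obtain ⟨a, ha⟩ := ((tendsto_order.1 (tendsto_cdf_atTop η)).1 u h1).exists
    exact ⟨a, ha.le⟩
  refine ⟨fun h => ?_, fun h => csInf_le hbdd h⟩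
  have hright : Tendsto (cdf η) (𝓝[>] s) (𝓝 (cdf η s)) :=
    ((cdf η).right_continuous s).mono Set.Ioi_subset_Ici_self
  refine ge_of_tendsto hright ?_
  filter_upwards [self_mem_nhdsWithin] with x hx
  obtain ⟨y, hy, hyx⟩ := exists_lt_of_csInf_lt hne (lt_of_le_of_lt h hx)
  exact le_trans hy (monotone_cdf η hyx.le)

lemma measurable_quantile (η : Measure ℝ) : Measurable (quantile η) := by
  -- Outside `(0, 1]` the set is `ℝ` or empty, where `sInf` defaults to `0`. At `u = 1` either case
  -- may occur, so that point is split off.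
  have hlow : ∀ u ≤ 0, quantile η u = 0 := fun u hu => by
    have : {x : ℝ | u ≤ cdf η x} = Set.univ :=
      Set.eq_univ_of_forall fun x => hu.trans (cdf_nonneg η x)
    simp [quantile, this]
  have hhigh : ∀ u, 1 < u → quantile η u = 0 := fun u hu => by
    have : {x : ℝ | u ≤ cdf η x} = ∅ :=
      Set.eq_empty_of_forall_notMem fun x hx => absurd (hu.trans_le hx) (not_lt.2 (cdf_le_one η x))
    simp [quantile, this]
  refine measurable_of_Iic fun s => ?_
  have key : quantile η ⁻¹' Set.Iic s =
      (Set.Ioo 0 1 ∩ Set.Iic (cdf η s)) ∪ ({u | (u ≤ 0 ∨ 1 < u) ∧ 0 ≤ s} ∪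
        {u | u = 1 ∧ quantile η 1 ≤ s}) := by
    ext u
    simp only [Set.mem_preimage, Set.mem_Iic, Set.mem_union, Set.mem_inter_iff, Set.mem_Ioo,
      Set.mem_ofPred_eq]
    rcases le_or_gt u 0 with h | h
    · rw [hlow u h]; grind
    rcases lt_trichotomy u 1 with h' | rfl | h'
    · rw [quantile_le_iff η h h']; grind
    · simp
    · rw [hhigh u h']; grind
  rw [key]
  measurability

/-- On the unit interval, the sublevel set of the quantile function is `(-∞, F s]` up to a null
set. -/
lemma quantile_preimage_Iic_ae_eq (η : Measure ℝ) (s : ℝ) :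
    quantile η ⁻¹' Set.Iic s =ᵐ[volume.restrict (Set.Ioc 0 1)] Set.Iic (cdf η s) := by
  rw [← restrict_Ioo_eq_restrict_Ioc]
  filter_upwards [ae_restrict_mem measurableSet_Ioo] with u hu
  exact propext (quantile_le_iff η hu.1 hu.2 s)

lemma volume_restrict_Ioc_Iic {c : ℝ} (h1 : c ≤ 1) :
    (volume.restrict (Set.Ioc (0 : ℝ) 1)) (Set.Iic c) = ENNReal.ofReal c := by
  rw [Measure.restrict_apply measurableSet_Iic, Set.inter_comm, Set.Ioc_inter_Iic, min_eq_right h1,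
    Real.volume_Ioc, sub_zero]

instance : IsProbabilityMeasure (volume.restrict (Set.Ioc (0 : ℝ) 1)) := ⟨by simp⟩

/-- The quantile function pushes the uniform distribution on the unit interval forward to `η`. -/
lemma map_quantile (η : Measure ℝ) [IsProbabilityMeasure η] :
    (volume.restrict (Set.Ioc (0 : ℝ) 1)).map (quantile η) = η := by
  have := Measure.isProbabilityMeasure_map
    (μ := volume.restrict (Set.Ioc (0 : ℝ) 1)) (measurable_quantile η).aemeasurable
  refine Measure.ext_of_Iic _ _ fun s => ?_
  rw [Measure.map_apply (measurable_quantile η) measurableSet_Iic,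
    measure_congr (quantile_preimage_Iic_ae_eq η s),
    volume_restrict_Ioc_Iic (cdf_le_one η s), ofReal_cdf]

lemma measureReal_quantile_preimage_symmDiff_le (η : Measure ℝ) (s : ℝ) {c : ℝ} :
    (volume.restrict (Set.Ioc (0 : ℝ) 1)).real
      (symmDiff (quantile η ⁻¹' Set.Iic s) (Set.Iic c)) ≤ |cdf η s - c| := by
  have hae : (symmDiff (quantile η ⁻¹' Set.Iic s) (Set.Iic c) : Set ℝ)
      =ᵐ[volume.restrict (Set.Ioc 0 1)] (symmDiff (Set.Iic (cdf η s)) (Set.Iic c) : Set ℝ) :=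
    (quantile_preimage_Iic_ae_eq η s).symmDiff .rfl
  have hsub : symmDiff (Set.Iic (cdf η s)) (Set.Iic c) ⊆ Set.uIoc c (cdf η s) := by
    intro x hx
    simp only [Set.mem_symmDiff, Set.mem_Iic, Set.mem_uIoc] at hx ⊢
    grind
  rw [measureReal_congr hae]
  calc _ ≤ (volume.restrict (Set.Ioc (0 : ℝ) 1)).real (Set.uIoc c (cdf η s)) :=
        measureReal_mono hsub
    _ ≤ volume.real (Set.uIoc c (cdf η s)) := by
        refine ENNReal.toReal_mono (by simp [Set.uIoc]) (Measure.restrict_apply_le _ _)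
    _ = |cdf η s - c| := by simp [Measure.real]

end Quantile

/-! ### Permutation measures on the grid and their marginals. -/

section PermMeasure

/-- The `i`-th of the `n` half-open subintervals of `(0, 1]` of equal length. -/
def gridCell (n i : ℕ) : Set ℝ := Set.Ioc ((i : ℝ) / n) ((i + 1 : ℝ) / n)

lemma measurableSet_gridCell (n i : ℕ) : MeasurableSet (gridCell n i) := measurableSet_Ioc

lemma mem_gridCell {n : ℕ} (hn : 0 < n) (i : ℕ) (x : ℝ) :
    x ∈ gridCell n i ↔ ⌈(n : ℝ) * x⌉ = (i : ℤ) + 1 := by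
  have hn' : (0 : ℝ) < n := by exact_mod_cast hn
  rw [gridCell, Set.mem_Ioc, div_lt_iff₀ hn', le_div_iff₀ hn', Int.ceil_eq_iff, mul_comm]
  push_cast
  simp

lemma volume_gridCell {n : ℕ} (hn : 0 < n) (i : ℕ) :
    volume (gridCell n i) = (n : ENNReal)⁻¹ := by
  have hn' : (0 : ℝ) < n := by exact_mod_cast hn
  rw [gridCell, Real.volume_Ioc, ← sub_div, add_sub_cancel_left, one_div,
    ENNReal.ofReal_inv_of_pos hn', ENNReal.ofReal_natCast]

lemma pairwise_disjoint_gridCell {n : ℕ} (hn : 0 < n) :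
    Pairwise (Function.onFun Disjoint (gridCell n)) := by
  intro i j hij
  refine Set.disjoint_left.2 fun x hi hj => hij ?_
  rw [mem_gridCell hn] at hi hj
  omega

lemma iUnion_gridCell {n : ℕ} (hn : 0 < n) :
    ⋃ i : Fin n, gridCell n i = Set.Ioc (0 : ℝ) 1 := by
  have hn' : (0 : ℝ) < n := by exact_mod_cast hn
  ext x
  simp only [Set.mem_iUnion, mem_gridCell hn, Set.mem_Ioc]
  constructor
  · rintro ⟨i, hi⟩
    rw [Int.ceil_eq_iff] at hi
    have hi' : ((i : ℕ) : ℝ) + 1 ≤ n := by exact_mod_cast i.2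
    push_cast at hi
    have h0 : (0 : ℝ) ≤ (i : ℕ) := by positivity
    constructor <;> nlinarith
  · rintro ⟨h0, h1⟩
    have hpos : 0 < ⌈(n : ℝ) * x⌉ := Int.ceil_pos.2 (by positivity)
    have hle : ⌈(n : ℝ) * x⌉ ≤ n := Int.ceil_le.2 (by push_cast; nlinarith)
    exact ⟨⟨(⌈(n : ℝ) * x⌉ - 1).toNat, by omega⟩, by simp only []; omega⟩

lemma sum_restrict_gridCell {n : ℕ} (hn : 0 < n) :
    ∑ i : Fin n, volume.restrict (gridCell n i) = volume.restrict (Set.Ioc (0 : ℝ) 1) := by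
  rw [← iUnion_gridCell hn, Measure.restrict_iUnion
    ((pairwise_disjoint_gridCell hn).comp_of_injective Fin.val_injective)
    (fun i => measurableSet_gridCell n i), Measure.sum_fintype]

/-- The density is constant on `n` disjoint squares of side `1/n`, one per row and column, all
inside the unit square. -/
lemma permMeasure_eq_sum {n : ℕ} (hn : 0 < n) (σ : Equiv.Perm (Fin n)) :
    permMeasure σ = ∑ i : Fin n, (n : ENNReal) •
      (volume.restrict (gridCell n i)).prod (volume.restrict (gridCell n (σ i))) := by
  have hS : {p : ℝ × ℝ | ∃ i : Fin n,
      ⌈(n : ℝ) * p.1⌉ = ((i : ℕ) : ℤ) + 1 ∧ ⌈(n : ℝ) * p.2⌉ = ((σ i : ℕ) : ℤ) + 1} =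
      ⋃ i : Fin n, gridCell n i ×ˢ gridCell n (σ i) := by
    ext p
    simp [mem_gridCell hn]
  have hmeas : ∀ i : Fin n, MeasurableSet (gridCell n i ×ˢ gridCell n (σ i)) := fun i =>
    (measurableSet_gridCell _ _).prod (measurableSet_gridCell _ _)
  have hIcc : ∀ i : Fin n, gridCell n i ⊆ Set.Icc 0 1 := fun i =>
    ((Set.subset_iUnion (fun i : Fin n => gridCell n i) i).trans
      (iUnion_gridCell hn).subset).trans Set.Ioc_subset_Icc_self
  rw [permMeasure, permDensity, hS, withDensity_indicator (.iUnion hmeas), withDensity_const,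
    Measure.restrict_restrict (.iUnion hmeas), Set.inter_eq_self_of_subset_left
      (Set.iUnion_subset fun i => Set.prod_mono (hIcc i) (hIcc _)),
    Measure.restrict_iUnion _ hmeas, Measure.sum_fintype, Finset.smul_sum]
  · simp_rw [Measure.prod_restrict, Measure.volume_eq_prod]
  · intro i j hij
    exact Set.disjoint_prod.2
      (.inl (pairwise_disjoint_gridCell hn (fun h => hij (Fin.ext h))))

lemma permMeasure_prod {n : ℕ} (hn : 0 < n) (σ : Equiv.Perm (Fin n)) (A B : Set ℝ) :
    permMeasure σ (A ×ˢ B) = ∑ i : Fin n, (n : ENNReal) *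
      (volume.restrict (gridCell n i) A * volume.restrict (gridCell n (σ i)) B) := by
  simp [permMeasure_eq_sum hn σ, Measure.finsetSum_apply, Measure.prod_prod]

lemma map_fst_permMeasure {n : ℕ} (hn : 0 < n) (σ : Equiv.Perm (Fin n)) :
    (permMeasure σ).map Prod.fst = volume.restrict (Set.Ioc (0 : ℝ) 1) := by
  have hn0 : (n : ENNReal) ≠ 0 := by exact_mod_cast hn.ne'
  ext A hA
  rw [Measure.map_apply measurable_fst hA, ← Set.prod_univ, permMeasure_prod hn,
    ← sum_restrict_gridCell hn, Measure.finsetSum_apply]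
  refine Finset.sum_congr rfl fun i _ => ?_
  rw [Measure.restrict_apply_univ, volume_gridCell hn, mul_comm, mul_assoc,
    ENNReal.inv_mul_cancel hn0 (ENNReal.natCast_ne_top n), mul_one]

lemma map_snd_permMeasure {n : ℕ} (hn : 0 < n) (σ : Equiv.Perm (Fin n)) :
    (permMeasure σ).map Prod.snd = volume.restrict (Set.Ioc (0 : ℝ) 1) := by
  have hn0 : (n : ENNReal) ≠ 0 := by exact_mod_cast hn.ne'
  ext A hA
  rw [Measure.map_apply measurable_snd hA, ← Set.univ_prod, permMeasure_prod hn,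
    ← sum_restrict_gridCell hn, Measure.finsetSum_apply,
    -- Bijectivity of `σ` enters here: every column is hit exactly once.
    ← Equiv.sum_comp σ fun i : Fin n => volume.restrict (gridCell n i) A]
  refine Finset.sum_congr rfl fun i _ => ?_
  rw [Measure.restrict_apply_univ, volume_gridCell hn, ← mul_assoc,
    ENNReal.mul_inv_cancel hn0 (ENNReal.natCast_ne_top n), one_mul]

lemma isProbabilityMeasure_permMeasure {n : ℕ} (hn : 0 < n) (σ : Equiv.Perm (Fin n)) :
    IsProbabilityMeasure (permMeasure σ) := by
  constructor
  have h : (permMeasure σ).map Prod.fst Set.univ = 1 := by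
    rw [map_fst_permMeasure hn]; exact measure_univ
  rwa [Measure.map_apply measurable_fst .univ, Set.preimage_univ] at h

lemma permCoupling_mem_couplings (η : Measure ℝ) [IsProbabilityMeasure η] {n : ℕ} (hn : 0 < n)
    (σ : Equiv.Perm (Fin n)) : permCoupling η σ ∈ couplings η := by
  have hq := measurable_quantile η
  constructor
  · rw [permCoupling, Measure.map_map measurable_fst (hq.prodMap hq),
      show Prod.fst ∘ Prod.map (quantile η) (quantile η) = quantile η ∘ Prod.fst from rfl,
      ← Measure.map_map hq measurable_fst, map_fst_permMeasure hn, map_quantile]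
  · rw [permCoupling, Measure.map_map measurable_snd (hq.prodMap hq),
      show Prod.snd ∘ Prod.map (quantile η) (quantile η) = quantile η ∘ Prod.snd from rfl,
      ← Measure.map_map hq measurable_snd, map_snd_permMeasure hn, map_quantile]

lemma volume_restrict_gridCell_Iic {n : ℕ} (hn : 0 < n) (i j : ℕ) :
    volume.restrict (gridCell n i) (Set.Iic ((j : ℝ) / n)) =
      if i < j then (n : ENNReal)⁻¹ else 0 := by
  have hn' : (0 : ℝ) < n := by exact_mod_cast hn
  rw [Measure.restrict_apply measurableSet_Iic]
  split_ifs with h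
  · rw [Set.inter_eq_self_of_subset_right, volume_gridCell hn]
    rintro x ⟨-, hx⟩
    refine hx.trans ?_
    have : (i : ℝ) + 1 ≤ j := by exact_mod_cast h
    gcongr
  · convert! measure_empty (μ := volume)
    refine Set.eq_empty_of_forall_notMem ?_
    rintro x ⟨hx, hx', -⟩
    have : (j : ℝ) ≤ i := by exact_mod_cast not_lt.1 h
    have : (j : ℝ) / n ≤ i / n := by gcongr
    exact absurd (hx'.trans_le hx) (not_lt.2 this)

/-- A cut at a grid point leaves each cell wholly on one side, so the mass is a count. -/
lemma permMeasure_real_Iic_prod_Iic {n : ℕ} (hn : 0 < n) (σ : Equiv.Perm (Fin n)) (j l : ℕ) :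
    (permMeasure σ).real (Set.Iic ((j : ℝ) / n) ×ˢ Set.Iic ((l : ℝ) / n)) =
      (Finset.univ.filter fun i : Fin n => (i : ℕ) < j ∧ (σ i : ℕ) < l).card / n := by
  have hn0 : (n : ENNReal) ≠ 0 := by exact_mod_cast hn.ne'
  have : permMeasure σ (Set.Iic ((j : ℝ) / n) ×ˢ Set.Iic ((l : ℝ) / n)) =
      (Finset.univ.filter fun i : Fin n => (i : ℕ) < j ∧ (σ i : ℕ) < l).card / n := by
    rw [permMeasure_prod hn, Finset.card_filter, Nat.cast_sum, ENNReal.div_eq_inv_mul,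
      Finset.mul_sum]
    refine Finset.sum_congr rfl fun i _ => ?_
    rw [volume_restrict_gridCell_Iic hn, volume_restrict_gridCell_Iic hn]
    by_cases h1 : (i : ℕ) < j <;> by_cases h2 : (σ i : ℕ) < l <;> simp [h1, h2]
    rw [← mul_assoc, ENNReal.mul_inv_cancel hn0 (ENNReal.natCast_ne_top n), one_mul]
  rw [Measure.real, this]
  simp

/-- Changing a product set changes its measure by at most the marginal measures of the changes. -/
lemma abs_measureReal_prod_sub_le {P : Measure (ℝ × ℝ)} [IsProbabilityMeasure P] {A A' B B' : Set ℝ}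
    (hA : MeasurableSet A) (hA' : MeasurableSet A') (hB : MeasurableSet B)
    (hB' : MeasurableSet B') :
    |P.real (A ×ˢ B) - P.real (A' ×ˢ B')| ≤
      (P.map Prod.fst).real (symmDiff A A') + (P.map Prod.snd).real (symmDiff B B') := by
  rw [map_measureReal_apply measurable_fst (hA.symmDiff hA'),
    map_measureReal_apply measurable_snd (hB.symmDiff hB')]
  refine (abs_measureReal_sub_le_measureReal_symmDiff (hA.prod hB).nullMeasurableSet
    (hA'.prod hB').nullMeasurableSet).trans
    ((measureReal_mono ?_).trans (measureReal_union_le _ _))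
  rintro ⟨x, y⟩ h
  simp only [Set.mem_symmDiff, Set.mem_prod, Set.mem_union, Set.mem_preimage] at h ⊢
  tauto

/-- The bound is uniform in `σ`, because only the marginals enter and these are always uniform. -/
lemma abs_permCoupling_real_sub_le (η : Measure ℝ) [IsProbabilityMeasure η] {n : ℕ} (hn : 0 < n)
    (σ : Equiv.Perm (Fin n)) (s t : ℝ) (j l : ℕ) :
    |(permCoupling η σ).real (Set.Iic s ×ˢ Set.Iic t) -
      ((Finset.univ.filter fun i : Fin n => (i : ℕ) < j ∧ (σ i : ℕ) < l).card : ℝ) / n| ≤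
      |cdf η s - (j : ℝ) / n| + |cdf η t - (l : ℝ) / n| := by
  have := isProbabilityMeasure_permMeasure hn σ
  have hq := measurable_quantile η
  rw [permCoupling, map_measureReal_apply (hq.prodMap hq) (measurableSet_Iic.prod measurableSet_Iic),
    Set.preimage_prod_map_prod, ← permMeasure_real_Iic_prod_Iic hn]
  refine (abs_measureReal_prod_sub_le (hq measurableSet_Iic) measurableSet_Iic
    (hq measurableSet_Iic) measurableSet_Iic).trans ?_
  rw [map_fst_permMeasure hn, map_snd_permMeasure hn]
  exact add_le_add (measureReal_quantile_preimage_symmDiff_le η s)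
    (measureReal_quantile_preimage_symmDiff_le η t)

end PermMeasure

/-! ### Density of permutation couplings. -/

noncomputable section Approximation

/-- The permutation matching the rank of the first coordinate of each point of a finite sample with
the rank of its second coordinate. -/
def rankPerm {n : ℕ} (z : Fin n → ℝ × ℝ) : Equiv.Perm (Fin n) :=
  (Tuple.sort fun k => (z k).1).trans (Tuple.sort fun k => (z k).2).symm

lemma lt_card_filter_iff_sort_le {n : ℕ} (x : Fin n → ℝ) (s : ℝ) (i : Fin n) :
    (i : ℕ) < (Finset.univ.filter fun k => x k ≤ s).card ↔ x (Tuple.sort x i) ≤ s := by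
  have hcard : (Finset.univ.filter fun k => x k ≤ s).card =
      (Finset.univ.filter fun k => (x ∘ Tuple.sort x) k ≤ s).card :=
    (Finset.card_bij (fun k _ => Tuple.sort x k) (by simp) (by simp)
      (fun k hk => ⟨(Tuple.sort x).symm k, by simpa using hk, by simp⟩)).symm
  rw [hcard]
  exact Tuple.lt_card_le_iff_apply_le_of_monotone (Tuple.monotone_sort x)

/-- Position `i` in the first ordering and `rankPerm z i` in the second belong to the same sample
point. Ties are harmless, since each cut-off takes in all points up to its level. -/
lemma card_filter_rankPerm {n : ℕ} (z : Fin n → ℝ × ℝ) (s t : ℝ) :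
    (Finset.univ.filter fun i : Fin n =>
      (i : ℕ) < (Finset.univ.filter fun k => (z k).1 ≤ s).card ∧
      (rankPerm z i : ℕ) < (Finset.univ.filter fun k => (z k).2 ≤ t).card).card =
    (Finset.univ.filter fun k => (z k).1 ≤ s ∧ (z k).2 ≤ t).card := by
  simp_rw [lt_card_filter_iff_sort_le (fun k => (z k).1) s,
    lt_card_filter_iff_sort_le (fun k => (z k).2) t]
  refine Finset.card_bij (fun k _ => Tuple.sort (fun k => (z k).1) k)
    (by simp [rankPerm]) (by simp)
    (fun k hk => ⟨(Tuple.sort fun k => (z k).1).symm k, by simpa [rankPerm] using hk, by simp⟩)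

/-- The empirical frequency of a set in a finite sample. -/
def empFreq {α : Type*} (z : ℕ → α) (A : Set α) (n : ℕ) : ℝ :=
  (∑ i ∈ Finset.range n, A.indicator 1 (z i)) / n

lemma empFreq_eq_card {α : Type*} (z : ℕ → α) (p : α → Prop) [DecidablePred p] (n : ℕ) :
    empFreq z {a | p a} n = (Finset.univ.filter fun k : Fin n => p (z k)).card / n := by
  rw [empFreq, Finset.card_filter, ← Fin.sum_univ_eq_sum_range
    (fun i => Set.indicator {a | p a} (1 : α → ℝ) (z i)) n]
  simp [Set.indicator_apply]

/-- A probability measure has a sequence of points whose empirical frequencies converge to its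
values on countably many given sets. -/
lemma exists_seq_tendsto_empFreq {α ι : Type*} [MeasurableSpace α] [Countable ι] (μ : Measure α)
    [IsProbabilityMeasure μ] {A : ι → Set α} (hA : ∀ i, MeasurableSet (A i)) :
    ∃ z : ℕ → α, ∀ i, Tendsto (empFreq z (A i)) atTop (𝓝 (μ.real (A i))) := by
  -- Almost every i.i.d. sample works: the strong law applies to each indicator, and there are
  -- countably many.
  let P := Measure.infinitePi fun _ : ℕ => μ
  have hmap : ∀ k, P.map (fun ω : ℕ → α => ω k) = μ := fun k =>
    Measure.infinitePi_map_eval (fun _ : ℕ => μ) k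
  suffices h : ∀ᵐ z ∂P, ∀ i, Tendsto (empFreq z (A i)) atTop (𝓝 (μ.real (A i))) from h.exists
  rw [ae_all_iff]
  intro i
  have hind : Measurable ((A i).indicator (1 : α → ℝ)) := measurable_one.indicator (hA i)
  let X : ℕ → (ℕ → α) → ℝ := fun k ω => (A i).indicator 1 (ω k)
  have hX : ∀ k, Measurable (X k) := fun k => hind.comp (measurable_pi_apply k)
  have hid : ∀ k, IdentDistrib (X k) (X 0) P P := fun k =>
    ((⟨(measurable_pi_apply k).aemeasurable, (measurable_pi_apply 0).aemeasurable,
      by rw [hmap, hmap]⟩ : IdentDistrib (fun ω : ℕ → α => ω k) (fun ω => ω 0) P P).comp hind)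
  have hint : Integrable (X 0) P := by
    refine Integrable.of_bound (hX 0).aestronglyMeasurable 1 (ae_of_all _ fun ω => ?_)
    by_cases h : ω 0 ∈ A i <;> simp [X, h]
  have hindep : iIndepFun X P := iIndepFun_infinitePi (P := fun _ : ℕ => μ)
    (X := fun _ => (A i).indicator (1 : α → ℝ)) (fun _ => hind)
  have hexp : P[X 0] = μ.real (A i) := by
    rw [← integral_indicator_one (hA i), ← hmap 0,
      integral_map (measurable_pi_apply 0).aemeasurable hind.aestronglyMeasurable]
  filter_upwards [strong_law_ae_real X hint (fun j k hjk => hindep.indepFun hjk) hid] with z hz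
  rwa [hexp] at hz

lemma measureReal_Ioc_prod_Ioc (μ : Measure (ℝ × ℝ)) [IsFiniteMeasure μ] {a b c d : ℝ}
    (hab : a ≤ b) (hcd : c ≤ d) :
    μ.real (Set.Ioc a b ×ˢ Set.Ioc c d) =
      μ.real (Set.Iic b ×ˢ Set.Iic d) - μ.real (Set.Iic a ×ˢ Set.Iic d) -
        (μ.real (Set.Iic b ×ˢ Set.Iic c) - μ.real (Set.Iic a ×ˢ Set.Iic c)) := by
  have h1 : ∀ e : ℝ, μ.real (Set.Ioc a b ×ˢ Set.Iic e) =
      μ.real (Set.Iic b ×ˢ Set.Iic e) - μ.real (Set.Iic a ×ˢ Set.Iic e) := fun e => by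
    rw [← measureReal_sdiff (Set.prod_mono (Set.Iic_subset_Iic.2 hab) subset_rfl)
      (measurableSet_Iic.prod measurableSet_Iic),
      Set.prod_sdiff_prod, Set.sdiff_self, Set.prod_empty, Set.empty_union, Set.Iic_sdiff_Iic]
  rw [← h1, ← h1, ← measureReal_sdiff (Set.prod_mono subset_rfl (Set.Iic_subset_Iic.2 hcd))
      (measurableSet_Ioc.prod measurableSet_Iic),
    Set.prod_sdiff_prod, Set.sdiff_self, Set.empty_prod, Set.union_empty, Set.Iic_sdiff_Iic]

/-- Pointwise convergence of joint distribution functions at the rational points implies weak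
convergence. -/
lemma tendsto_of_tendsto_measureReal_Iic_prod_Iic {ν : ℕ → ProbabilityMeasure (ℝ × ℝ)}
    {μ : ProbabilityMeasure (ℝ × ℝ)}
    (h : ∀ q r : ℚ, Tendsto
      (fun n => (ν n : Measure (ℝ × ℝ)).real (Set.Iic (q : ℝ) ×ˢ Set.Iic (r : ℝ))) atTop
      (𝓝 ((μ : Measure (ℝ × ℝ)).real (Set.Iic (q : ℝ) ×ˢ Set.Iic (r : ℝ))))) :
    Tendsto ν atTop (𝓝 μ) := by
  -- Rational rectangles form a π-system containing arbitrarily small neighbourhoods of each point,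
  -- so convergence on them suffices.
  let S : Set (Set (ℝ × ℝ)) := Set.range fun v : (ℚ × ℚ) × (ℚ × ℚ) =>
    Set.Ioc (v.1.1 : ℝ) v.1.2 ×ˢ Set.Ioc (v.2.1 : ℝ) v.2.2
  have hS : IsPiSystem S := by
    rintro _ ⟨v, rfl⟩ _ ⟨w, rfl⟩ -
    refine ⟨((max v.1.1 w.1.1, min v.1.2 w.1.2), (max v.2.1 w.2.1, min v.2.2 w.2.2)), ?_⟩
    simp [Set.prod_inter_prod, Set.Ioc_inter_Ioc]
  refine hS.tendsto_probabilityMeasure_of_tendsto_of_mem ?_ ?_ ?_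
  · rintro _ ⟨v, rfl⟩
    exact measurableSet_Ioc.prod measurableSet_Ioc
  · rintro u hu ⟨x, y⟩ hxy
    obtain ⟨ε, hε, hball⟩ := Metric.isOpen_iff.1 hu _ hxy
    obtain ⟨a, ha, ha'⟩ := exists_rat_btwn (sub_lt_self x hε)
    obtain ⟨b, hb, hb'⟩ := exists_rat_btwn (lt_add_of_pos_right x hε)
    obtain ⟨c, hc, hc'⟩ := exists_rat_btwn (sub_lt_self y hε)
    obtain ⟨d, hd, hd'⟩ := exists_rat_btwn (lt_add_of_pos_right y hε)
    refine ⟨_, ⟨((a, b), (c, d)), rfl⟩,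
      prod_mem_nhds (Ioc_mem_nhds ha' hb) (Ioc_mem_nhds hc' hd), Set.Subset.trans ?_ hball⟩
    rintro ⟨x', y'⟩ ⟨⟨h1, h2⟩, h3, h4⟩
    rw [← ball_prod_same, Real.ball_eq_Ioo, Real.ball_eq_Ioo]
    exact ⟨⟨ha.trans h1, h2.trans_lt hb'⟩, hc.trans h3, h4.trans_lt hd'⟩
  · rintro _ ⟨⟨⟨a, b⟩, c, d⟩, rfl⟩
    rw [← NNReal.tendsto_coe]
    dsimp only
    rcases lt_or_ge b a with hab | hab
    · simp [Set.Ioc_eq_empty_of_le (show (b : ℝ) ≤ a by exact_mod_cast hab.le)]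
    rcases lt_or_ge d c with hcd | hcd
    · simp [Set.Ioc_eq_empty_of_le (show (d : ℝ) ≤ c by exact_mod_cast hcd.le)]
    have hab' : (a : ℝ) ≤ b := by exact_mod_cast hab
    have hcd' : (c : ℝ) ≤ d := by exact_mod_cast hcd
    have := ((h b d).sub (h a d)).sub ((h b c).sub (h a c))
    simp_rw [← measureReal_Ioc_prod_Ioc _ hab' hcd'] at this
    exact this

/-- Every coupling of `η` with itself is a weak limit of permutation couplings. -/
lemma exists_tendsto_of_mem_permClass (η : Measure ℝ) [IsProbabilityMeasure η]
    (μ : ProbabilityMeasure (ℝ × ℝ)) (hμ : (μ : Measure (ℝ × ℝ)) ∈ couplings η) :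
    ∃ ν : ℕ → ProbabilityMeasure (ℝ × ℝ),
      (∀ n : ℕ, 0 < n → (ν n : Measure (ℝ × ℝ)) ∈ permClass η n) ∧ Tendsto ν atTop (𝓝 μ) := by
  classical
  obtain ⟨z, hz⟩ := exists_seq_tendsto_empFreq (μ : Measure (ℝ × ℝ))
    (A := fun v : ℚ ⊕ ℚ ⊕ ℚ × ℚ => match v with
      | .inl q => {p : ℝ × ℝ | p.1 ≤ q}
      | .inr (.inl r) => {p : ℝ × ℝ | p.2 ≤ r}
      | .inr (.inr v) => {p : ℝ × ℝ | p.1 ≤ v.1 ∧ p.2 ≤ v.2})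
    (by
      rintro (q | r | v)
      · exact measurable_fst measurableSet_Iic
      · exact measurable_snd measurableSet_Iic
      · exact (measurable_fst measurableSet_Iic).inter (measurable_snd measurableSet_Iic))
  let σ : ∀ n, Equiv.Perm (Fin n) := fun n => rankPerm fun k : Fin n => z k
  have hprob : ∀ n, 0 < n → IsProbabilityMeasure (permCoupling η (σ n)) := fun n hn => by
    have := isProbabilityMeasure_permMeasure hn (σ n)
    exact Measure.isProbabilityMeasure_map
      ((measurable_quantile η).prodMap (measurable_quantile η)).aemeasurable
  -- For `n = 0` the permutation measure is zero, so `μ` serves as filler.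
  have hex : ∀ n, ∃ P : ProbabilityMeasure (ℝ × ℝ), 0 < n →
      (P : Measure (ℝ × ℝ)) = permCoupling η (σ n) := fun n => by
    by_cases hn : 0 < n
    · exact ⟨⟨_, hprob n hn⟩, fun _ => rfl⟩
    · exact ⟨μ, fun h => absurd h hn⟩
  choose ν hν using hex
  refine ⟨ν, fun n hn => ⟨σ n, (hν n hn).symm⟩, ?_⟩
  refine tendsto_of_tendsto_measureReal_Iic_prod_Iic fun q r => ?_
  have h1 := hz (.inl q)
  have h2 := hz (.inr (.inl r))
  have h3 := hz (.inr (.inr (q, r)))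
  dsimp only at h1 h2 h3
  have e1 : (μ : Measure (ℝ × ℝ)).real {p : ℝ × ℝ | p.1 ≤ q} = cdf η q := by
    rw [cdf_eq_real, ← hμ.1, map_measureReal_apply measurable_fst measurableSet_Iic]; rfl
  have e2 : (μ : Measure (ℝ × ℝ)).real {p : ℝ × ℝ | p.2 ≤ r} = cdf η r := by
    rw [cdf_eq_real, ← hμ.2, map_measureReal_apply measurable_snd measurableSet_Iic]; rfl
  rw [e1] at h1
  rw [e2] at h2
  have hbound : Tendsto (fun n => |cdf η q - empFreq z {p : ℝ × ℝ | p.1 ≤ q} n| +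
      |cdf η r - empFreq z {p : ℝ × ℝ | p.2 ≤ r} n|) atTop (𝓝 0) := by
    simpa using ((tendsto_const_nhds (x := cdf η q)).sub h1).abs.add
      ((tendsto_const_nhds (x := cdf η r)).sub h2).abs
  have hdiff : Tendsto (fun n =>
      (ν n : Measure (ℝ × ℝ)).real (Set.Iic (q : ℝ) ×ˢ Set.Iic (r : ℝ)) -
      empFreq z {p : ℝ × ℝ | p.1 ≤ q ∧ p.2 ≤ r} n) atTop (𝓝 0) := by
    refine squeeze_zero_norm' ?_ hbound
    filter_upwards [eventually_gt_atTop 0] with n hn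
    rw [hν n hn, Real.norm_eq_abs, empFreq_eq_card, empFreq_eq_card, empFreq_eq_card,
      ← card_filter_rankPerm (fun k : Fin n => z k)]
    -- The cut-offs are the sample counts, so `j/n` and `l/n` are the marginal empirical
    -- frequencies.
    exact abs_permCoupling_real_sub_le η hn (σ n) q r _ _
  have := hdiff.add h3
  simp only [sub_add_cancel, zero_add] at this
  exact this

end Approximation

/-! ### Variance versus transport cost. -/

section Variance

variable {η : Measure ℝ} {f : ℝ → ℝ} {μ : Measure (ℝ × ℝ)}

lemma measurePreserving_fst_of_mem_couplings (hμ : μ ∈ couplings η) :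
    MeasurePreserving Prod.fst μ η := ⟨measurable_fst, hμ.1⟩

lemma measurePreserving_snd_of_mem_couplings (hμ : μ ∈ couplings η) :
    MeasurePreserving Prod.snd μ η := ⟨measurable_snd, hμ.2⟩

lemma isProbabilityMeasure_of_mem_couplings [IsProbabilityMeasure η] (hμ : μ ∈ couplings η) :
    IsProbabilityMeasure μ :=
  (Measure.isProbabilityMeasure_map_iff measurable_fst.aemeasurable).1 (hμ.1 ▸ ‹_›)

lemma integral_comp_fst_of_mem_couplings (hμ : μ ∈ couplings η) (hf : AEStronglyMeasurable f η) :
    ∫ ω, f ω.1 ∂μ = ∫ x, f x ∂η := by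
  rw [← hμ.1] at hf ⊢
  exact (integral_map measurable_fst.aemeasurable hf).symm

lemma integral_comp_snd_of_mem_couplings (hμ : μ ∈ couplings η) (hf : AEStronglyMeasurable f η) :
    ∫ ω, f ω.2 ∂μ = ∫ x, f x ∂η := by
  rw [← hμ.2] at hf ⊢
  exact (integral_map measurable_snd.aemeasurable hf).symm

/-- The two-sample estimator is unbiased under every coupling. -/
lemma integral_pairEstimator (hμ : μ ∈ couplings η) (hf : Integrable f η) :
    ∫ ω, pairEstimator f ω ∂μ = ∫ x, f x ∂η := by
  have h1 : Integrable (fun ω : ℝ × ℝ => f ω.1) μ :=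
    (measurePreserving_fst_of_mem_couplings hμ).integrable_comp_of_integrable hf
  have h2 : Integrable (fun ω : ℝ × ℝ => f ω.2) μ :=
    (measurePreserving_snd_of_mem_couplings hμ).integrable_comp_of_integrable hf
  simp only [pairEstimator]
  rw [integral_div, integral_add h1 h2, integral_comp_fst_of_mem_couplings hμ hf.1,
    integral_comp_snd_of_mem_couplings hμ hf.1]
  ring

lemma memLp_pairEstimator (hμ : μ ∈ couplings η) (hf : MemLp f 2 η) :
    MemLp (pairEstimator f) 2 μ := by
  have h1 := hf.comp_measurePreserving (measurePreserving_fst_of_mem_couplings hμ)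
  have h2 := hf.comp_measurePreserving (measurePreserving_snd_of_mem_couplings hμ)
  have := (h1.add h2).const_mul (1 / 2)
  convert! this using 1
  ext ω
  simp [pairEstimator]
  ring

/-- With the marginals fixed, only the cross term depends on `μ`. -/
lemma variance_pairEstimator [IsProbabilityMeasure η] (hμ : μ ∈ couplings η) (hf : MemLp f 2 η) :
    variance (pairEstimator f) μ =
      (∫ x, f x ^ 2 ∂η) / 2 + (∫ ω, f ω.1 * f ω.2 ∂μ) / 2 - (∫ x, f x ∂η) ^ 2 := by
  have := isProbabilityMeasure_of_mem_couplings hμ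
  have h1 : MemLp (fun ω : ℝ × ℝ => f ω.1) 2 μ :=
    hf.comp_measurePreserving (measurePreserving_fst_of_mem_couplings hμ)
  have h2 : MemLp (fun ω : ℝ × ℝ => f ω.2) 2 μ :=
    hf.comp_measurePreserving (measurePreserving_snd_of_mem_couplings hμ)
  -- Square-integrability keeps the cost integral from being the default value `0`.
  have h12 : Integrable (fun ω : ℝ × ℝ => f ω.1 * f ω.2) μ := h1.integrable_mul h2
  have hsq : ∀ ω : ℝ × ℝ, (pairEstimator f ^ 2) ω =
      f ω.1 ^ 2 / 4 + f ω.2 ^ 2 / 4 + f ω.1 * f ω.2 / 2 := fun ω => by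
    simp only [Pi.pow_apply, pairEstimator]; ring
  rw [variance_eq_sub (memLp_pairEstimator hμ hf),
    integral_pairEstimator hμ (hf.integrable one_le_two), integral_congr_ae (ae_of_all _ hsq),
    integral_add (f := fun ω : ℝ × ℝ => f ω.1 ^ 2 / 4 + f ω.2 ^ 2 / 4)
      ((h1.integrable_sq.div_const 4).add (h2.integrable_sq.div_const 4)) (h12.div_const 2),
    integral_add (h1.integrable_sq.div_const 4) (h2.integrable_sq.div_const 4),
    integral_div, integral_div, integral_div,
    integral_comp_fst_of_mem_couplings (f := fun x => f x ^ 2) hμ (hf.1.pow 2),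
    integral_comp_snd_of_mem_couplings (f := fun x => f x ^ 2) hμ (hf.1.pow 2)]
  ring

/-- For square-integrable `f` the variance-minimising couplings are the optimal transport plans. -/
lemma isVarianceMinimising_iff_isOptimalPlan [IsProbabilityMeasure η] (hf : MemLp f 2 η)
    (μ : Measure (ℝ × ℝ)) : IsVarianceMinimising η f μ ↔ IsOptimalPlan η f μ := by
  refine and_congr_right fun hμ => forall₂_congr fun μ' hμ' => ?_
  have := isProbabilityMeasure_of_mem_couplings hμ
  have := isProbabilityMeasure_of_mem_couplings hμ'
  rw [← ofReal_variance (memLp_pairEstimator hμ hf), ← ofReal_variance (memLp_pairEstimator hμ' hf),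
    ENNReal.ofReal_le_ofReal_iff (variance_nonneg _ _), variance_pairEstimator hμ hf,
    variance_pairEstimator hμ' hf]
  constructor <;> intro h <;> linarith

end Variance

/-! ### Existence by the direct method. -/

section Existence

/-- The integral of a continuous nonnegative function is weakly lower semicontinuous. -/
lemma lowerSemicontinuous_lintegral_ofReal {Ω : Type*} [MeasurableSpace Ω] [TopologicalSpace Ω]
    [OpensMeasurableSpace Ω] {g : Ω → ℝ} (hg : Continuous g) :
    LowerSemicontinuous fun P : ProbabilityMeasure Ω =>
      ∫⁻ ω, ENNReal.ofReal (g ω) ∂(P : Measure Ω) := by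
  -- Truncation at `k` gives bounded continuous functions, whose integrals are weakly continuous;
  -- monotone convergence writes the full integral as their supremum.
  have hmeas : ∀ k : ℕ, Measurable fun ω => ENNReal.ofReal (min (g ω) k) := fun k =>
    (ENNReal.continuous_ofReal.comp (hg.min continuous_const)).measurable
  have hsup : ∀ P : ProbabilityMeasure Ω, ∫⁻ ω, ENNReal.ofReal (g ω) ∂(P : Measure Ω) =
      ⨆ k : ℕ, ∫⁻ ω, ENNReal.ofReal (min (g ω) k) ∂(P : Measure Ω) := fun P => by
    rw [← lintegral_iSup hmeas]
    · refine lintegral_congr fun ω => le_antisymm ?_ (iSup_le fun k => ?_)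
      · obtain ⟨k, hk⟩ := exists_nat_ge (g ω)
        exact le_iSup_of_le k (by rw [min_eq_left hk])
      · exact ENNReal.ofReal_le_ofReal (min_le_left _ _)
    · intro k l hkl ω
      have : (k : ℝ) ≤ l := by exact_mod_cast hkl
      dsimp only
      gcongr
  simp_rw [hsup]
  refine lowerSemicontinuous_iSup fun k => Continuous.lowerSemicontinuous ?_
  let φ : BoundedContinuousFunction Ω NNReal :=
    BoundedContinuousFunction.mkOfBound
      ⟨fun ω => (min (g ω) k).toNNReal, by fun_prop⟩ k (fun ω ω' => by
        have h : ∀ ω, ((min (g ω) k).toNNReal : ℝ) ≤ k := fun ω =>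
          (Real.coe_toNNReal' _).trans_le (max_le (min_le_right _ _) k.cast_nonneg)
        refine (NNReal.dist_eq _ _).trans_le (abs_sub_le_iff.2 ⟨?_, ?_⟩)
        · exact (sub_le_self _ (NNReal.coe_nonneg _)).trans (h ω)
        · exact (sub_le_self _ (NNReal.coe_nonneg _)).trans (h ω'))
  exact continuous_iff_continuousAt.2 fun P =>
    (ProbabilityMeasure.tendsto_iff_forall_lintegral_tendsto.1 tendsto_id φ)

/-- Prokhorov: tightness follows from that of the single marginal `η`, and closedness from
continuity of the marginal maps. -/
lemma isCompact_setOf_mem_couplings (η : Measure ℝ) [IsProbabilityMeasure η] :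
    IsCompact {P : ProbabilityMeasure (ℝ × ℝ) | (P : Measure (ℝ × ℝ)) ∈ couplings η} := by
  have htight : IsTightMeasureSet {((P : ProbabilityMeasure (ℝ × ℝ)) : Measure (ℝ × ℝ)) |
      P ∈ {P : ProbabilityMeasure (ℝ × ℝ) | (P : Measure (ℝ × ℝ)) ∈ couplings η}} := by
    refine .prodMk ((isTightMeasureSet_singleton (μ := η)).subset ?_)
      ((isTightMeasureSet_singleton (μ := η)).subset ?_)
    · rintro _ ⟨_, ⟨P, hP, rfl⟩, rfl⟩
      exact hP.1
    · rintro _ ⟨_, ⟨P, hP, rfl⟩, rfl⟩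
      exact hP.2
  have hclosed : IsClosed
      {P : ProbabilityMeasure (ℝ × ℝ) | (P : Measure (ℝ × ℝ)) ∈ couplings η} := by
    let η' : ProbabilityMeasure ℝ := ⟨η, inferInstance⟩
    have h1 := isClosed_singleton (x := η').preimage
      (ProbabilityMeasure.continuous_map (Ω := ℝ × ℝ) continuous_fst)
    have h2 := isClosed_singleton (x := η').preimage
      (ProbabilityMeasure.continuous_map (Ω := ℝ × ℝ) continuous_snd)
    convert! h1.inter h2 using 1
    ext P
    exact ⟨fun h => ⟨Subtype.ext h.1, Subtype.ext h.2⟩,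
      fun h => ⟨congrArg Subtype.val h.1, congrArg Subtype.val h.2⟩⟩
  have := isCompact_closure_of_isTightMeasureSet htight
  rwa [hclosed.closure_eq] at this

lemma exists_isVarianceMinimising (η : Measure ℝ) [IsProbabilityMeasure η] {f : ℝ → ℝ}
    (hf : Continuous f) (hfη : Integrable f η) :
    ∃ μ : Measure (ℝ × ℝ), IsVarianceMinimising η f μ := by
  -- By unbiasedness the centring constant is common to all couplings, so every variance integrates
  -- this one function.
  have hg : Continuous fun ω => (pairEstimator f ω - ∫ x, f x ∂η) ^ 2 := by
    unfold pairEstimator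
    fun_prop
  have hprod : η.prod η ∈ couplings η := ⟨by simp, by simp⟩
  have hne : {P : ProbabilityMeasure (ℝ × ℝ) | (P : Measure (ℝ × ℝ)) ∈ couplings η}.Nonempty :=
    ⟨⟨η.prod η, inferInstance⟩, hprod⟩
  obtain ⟨P, hP, hmin⟩ := ((lowerSemicontinuous_lintegral_ofReal hg).lowerSemicontinuousOn
    _).exists_isMinOn hne (isCompact_setOf_mem_couplings η)
  refine ⟨P, hP, fun μ' hμ' => ?_⟩
  have := isProbabilityMeasure_of_mem_couplings hμ'
  rw [evariance_eq_lintegral_ofReal, evariance_eq_lintegral_ofReal, integral_pairEstimator hP hfη,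
    integral_pairEstimator hμ' hfη]
  exact hmin (show (⟨μ', this⟩ : ProbabilityMeasure (ℝ × ℝ)) ∈ _ from hμ')

end Existence

theorem theorem4 (η : Measure ℝ) [IsProbabilityMeasure η] (hη : η ≪ volume)
    (f : ℝ → ℝ) (hf : Continuous f) (hfη : Integrable f η) :
    -- every member of the class of order `n` is a coupling
    (∀ n : ℕ, 0 < n → permClass η n ⊆ couplings η) ∧
    -- for square-integrable `f`, smallest variance means optimal for the cost `f ω₁ * f ω₂`
    (MemLp f 2 η → ∀ μ : Measure (ℝ × ℝ), IsVarianceMinimising η f μ ↔ IsOptimalPlan η f μ) ∧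
    -- an optimal plan exists
    (∃ μ : Measure (ℝ × ℝ), IsVarianceMinimising η f μ) ∧
    -- and each optimal plan is the weak limit of members of the classes of order `n → ∞`
    (∀ μ : ProbabilityMeasure (ℝ × ℝ), IsVarianceMinimising η f (μ : Measure (ℝ × ℝ)) →
      ∃ ν : ℕ → ProbabilityMeasure (ℝ × ℝ),
        (∀ n : ℕ, 0 < n → (ν n : Measure (ℝ × ℝ)) ∈ permClass η n) ∧
        Tendsto ν atTop (𝓝 μ)) := by
  refine ⟨?_, isVarianceMinimising_iff_isOptimalPlan, exists_isVarianceMinimising η hf hfη,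
    fun μ hμ => exists_tendsto_of_mem_permClass η μ hμ.1⟩
  rintro n hn _ ⟨σ, rfl⟩
  exact permCoupling_mem_couplings η hn σ
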